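/- All structures are finite, nonempty and relational, over finite vocabularies. A generalized quantifier $Q_{\mathcal K}$ is given by an isomorphism-closed class $\mathcal K$ of $\tau$-structures for some vocabulary $\tau$. In a structure $\mathbf A$ with assignment $\alpha$, the formula $Q_{\mathcal K}\,\bar y_1,\dots,\bar y_m\,(\psi_1,\dots,\psi_m)$ is true iff the $\tau$-structure with universe $A$ and relations $\{\bar b \mid (\mathbf A,\alpha[\bar b/\bar y_i])\models\psi_i\}$ belongs to $\mathcal K$. The arity of $Q_{\mathcal K}$ is the maximum arity of the symbols of $\tau$, and $\mathcal Q_r$ is the collection of all quantifiers of arity at most $r$. For a collection $\mathcal Q$ of quantifiers, $\mathcal L(\mathcal Q)=\bigcup_k\mathcal L^k(\mathcal Q)$, where $\mathcal L^k(\mathcal Q)$ is the extension by the quantifiers in $\mathcal Q$ of the infinitary logic with $k$ variables. We write $\mathcal L(\mathcal Q)\le\mathcal L(\mathcal Q')$ if every sentence of $\mathcal L(\mathcal Q)$ is equivalent, on all (finite) structures of its vocabulary, to a sentence of $\mathcal L(\mathcal Q')$. For $\ell\ge 3$, the partial near-unanimity function $n^\ell_A\colon A^\ell\to A$ has the value $a$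 if at least $\ell-1$ of its arguments equal $a$, and is undefined if there is no such $a$. For a structure $\mathbf B$, let $n^\ell(\mathbf B)$ be the structure with the same universe whose relations consist of all tuples obtained by applying $n^\ell$ columnwise to $\ell$ tuples of the corresponding relation of $\mathbf B$. The function $n^\ell$ is a partial polymorphism of $\mathbf B$ if every relation of $n^\ell(\mathbf B)$ is contained in that of $\mathbf B$. The quantifier $Q_{\mathcal K}$ is $\mathcal N^\ell$-closed if, for every $\mathbf B\in\mathcal K$, every structure $\mathbf A$ on the same universe whose relations are contained in those of $\mathbf B\cup n^\ell(\mathbf B)$ is also in $\mathcal K$. Let $\mathrm{CSP}(\mathbf B)$ be the class of all structures that map homomorphically to $\mathbf B$, and let $\mathcal Q^{\mathcal N^\ell_{\mathrm{CSP}}}_{r}$ be the collection of all $\mathcal N^\ell$-closed quantifiers of arity at most $r$ whose class is of the form $\mathrm{CSP}(\mathbf B)$. In the $k,r$-bijection game on $\mathbf A,\mathbf B$, positions are pairs $(\alpha,\beta)$ of partial assignments of $\{x_1,\dots,x_k\}$ in $\mathbf A$ and in $\mathbf B$ with equal domains, initially empty. In each round Duplicator chooses a bijection $f\colon A\to B$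 (and loses if there is none). Spoiler then chooses an $r$-tuple $\bar y$ of distinct variables and $\bar a\in A^r$, and the position becomes $(\alpha[\bar a/\bar y],\beta[f(\bar a)/\bar y])$. Spoiler wins if this does not induce a partial isomorphism from $\mathbf A$ to $\mathbf B$. Duplicator wins if Spoiler never wins. **Theorem.** For every $\ell\ge 3$, $$\mathcal L\bigl(\mathcal Q^{\mathcal N^\ell_{\mathrm{CSP}}}_{\ell+1}\bigr)\not\le\mathcal L(\mathcal Q_{\ell-1}).$$ Moreover, there is a structure $\mathbf B$ with universe $\mathbb Z_3$, all of whose relation symbols are $(\ell+1)$-ary, such that $n^\ell$ is a partial polymorphism of $\mathbf B$, the quantifier $Q_{\mathrm{CSP}(\mathbf B)}$ belongs to $\mathcal Q^{\mathcal N^\ell_{\mathrm{CSP}}}_{\ell+1}$, the class $\mathrm{CSP}(\mathbf B)$ is not definable by a sentence of $\mathcal L(\mathcal Q_{\ell-1})$, and for every $k\ge\ell-1$ there are structures $\mathbf A\in\mathrm{CSP}(\mathbf B)$ and $\tilde{\mathbf A}\notin\mathrm{CSP}(\mathbf B)$ such that Duplicator has a winning strategy in the $k,(\ell-1)$-bijection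 game on $\mathbf A$ and $\tilde{\mathbf A}$. -/

import Mathlib

open scoped FirstOrder

/-- A relational vocabulary with finitely many relation symbols. -/
structure FinRelational (τ : FirstOrder.Language.{0, 0}) : Prop where
  relational : τ.IsRelational
  finite_relations : Finite (Σ n, τ.Relations n)

/-- Finite (nonempty) structures over the vocabulary `τ`. -/
structure FinStr (τ : FirstOrder.Language.{0, 0}) where
  carrier : Type
  str : τ.Structure carrier
  finite : Finite carrier
  nonempty : Nonempty carrier

attribute [instance] FinStr.str FinStr.finite FinStr.nonempty

/-- The structure `S` on the finite nonempty set `A`, as an element of `FinStr τ`. -/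
def FinStr.of {τ : FirstOrder.Language.{0, 0}} (A : Type) [Finite A] [Nonempty A]
    (S : τ.Structure A) : FinStr τ :=
  ⟨A, S, inferInstance, inferInstance⟩

/-- There is a homomorphism from `A` to `B`. -/
def FinStr.MapsTo {τ : FirstOrder.Language.{0, 0}} (A B : FinStr τ) : Prop :=
  Nonempty (A.carrier →[τ] B.carrier)

/-- A generalized (Lindström) quantifier, given by an isomorphism-closed class of finite
structures over a finite relational vocabulary. -/
structure Quantifier where
  voc : FirstOrder.Language.{0, 0}
  finRelational : FinRelational voc
  cls : Set (FinStr voc)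
  iso_closed : ∀ A B : FinStr voc, Nonempty (A.carrier ≃[voc] B.carrier) → A ∈ cls → B ∈ cls

/-- All relation symbols of the vocabulary of `Q` have arity at most `r`. -/
def Quantifier.ArityLE (Q : Quantifier) (r : ℕ) : Prop :=
  ∀ n, Nonempty (Q.voc.Relations n) → n ≤ r

/-- The collection of all generalized quantifiers of arity at most `r`. -/
def quantifiersOfArity (r : ℕ) : Set Quantifier := {Q | Q.ArityLE r}

/-! ### The infinitary finite-variable logic with generalized quantifiers -/

/-- Formulas of the `k`-variable infinitary logic over the vocabulary `σ`, extended by the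
quantifiers in `𝒬`. The variables are the elements of `Fin k`. In the last rule, the tuple of
(distinct) variables `y n R` is bound in the formula `ψ n R`. -/
inductive Formula (σ : FirstOrder.Language.{0, 0}) (𝒬 : Set Quantifier) (k : ℕ) : Type 1
  | eq (i j : Fin k) : Formula σ 𝒬 k
  | rel (n : ℕ) (R : σ.Relations n) (x : Fin n → Fin k) : Formula σ 𝒬 k
  | neg (φ : Formula σ 𝒬 k) : Formula σ 𝒬 k
  | conj (ι : Type) (φ : ι → Formula σ 𝒬 k) : Formula σ 𝒬 k
  | disj (ι : Type) (φ : ι → Formula σ 𝒬 k) : Formula σ 𝒬 k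
  | ex (i : Fin k) (φ : Formula σ 𝒬 k) : Formula σ 𝒬 k
  | all (i : Fin k) (φ : Formula σ 𝒬 k) : Formula σ 𝒬 k
  | quant (Q : Quantifier) (hQ : Q ∈ 𝒬)
      (y : ∀ n, Q.voc.Relations n → (Fin n ↪ Fin k))
      (ψ : ∀ n, Q.voc.Relations n → Formula σ 𝒬 k) : Formula σ 𝒬 k

namespace Formula

variable {σ : FirstOrder.Language.{0, 0}} {𝒬 : Set Quantifier} {k : ℕ}

/-- The set of free variables. -/
def freeVars : Formula σ 𝒬 k → Set (Fin k)
  | eq i j => {i, j}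
  | rel _ _ x => Set.range x
  | neg φ => φ.freeVars
  | conj _ φ => ⋃ i, (φ i).freeVars
  | disj _ φ => ⋃ i, (φ i).freeVars
  | ex i φ => φ.freeVars \ {i}
  | all i φ => φ.freeVars \ {i}
  | quant _ _ y ψ => ⋃ n, ⋃ R, (ψ n R).freeVars \ Set.range (y n R)

/-- A sentence is a formula without free variables. -/
def IsSentence (φ : Formula σ 𝒬 k) : Prop := φ.freeVars = ∅

end Formula

open Classical in
/-- The assignment `α[b/y]`, for a tuple `y` of distinct variables. -/
noncomputable def updateTuple {A : Type} {k n : ℕ} (α : Fin k → A) (y : Fin n ↪ Fin k)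
    (b : Fin n → A) : Fin k → A :=
  fun v => if h : ∃ i, y i = v then b h.choose else α v

theorem updateTuple_apply {A : Type} {k n : ℕ} (α : Fin k → A) (y : Fin n ↪ Fin k)
    (b : Fin n → A) (i : Fin n) : updateTuple α y b (y i) = b i := by
  have h : ∃ j, y j = y i := ⟨i, rfl⟩
  have h2 : h.choose = i := y.injective h.choose_spec
  simp only [updateTuple, dif_pos h, h2]

theorem updateTuple_of_notMem {A : Type} {k n : ℕ} (α : Fin k → A) (y : Fin n ↪ Fin k)
    (b : Fin n → A) (v : Fin k) (hv : v ∉ Set.range y) : updateTuple α y b v = α v := by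
  have h : ¬ ∃ j, y j = v := hv
  simp only [updateTuple, dif_neg h]

/-- The structure on `A` over the relational vocabulary `τ` with the given relations. -/
@[reducible] def structureOfRel {τ : FirstOrder.Language.{0, 0}} (h : FinRelational τ) {A : Type}
    (r : ∀ n, τ.Relations n → (Fin n → A) → Prop) : τ.Structure A where
  funMap := fun {n} f _ => ((h.relational n).false f).elim
  RelMap := fun {n} R x => r n R x

/-- The truth of a formula in the structure `A` under an assignment. In the case of a quantifier
`Q`, the interpreted structure has the universe of `A`, and its relation `R` consists of the
tuples `b` for which `ψ n R` holds under `α[b/y n R]`. -/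
def Formula.Realize {σ : FirstOrder.Language.{0, 0}} {𝒬 : Set Quantifier} {k : ℕ} (A : FinStr σ) :
    Formula σ 𝒬 k → (Fin k → A.carrier) → Prop
  | eq i j, α => α i = α j
  | rel _ R x, α => FirstOrder.Language.Structure.RelMap R (fun m => α (x m))
  | neg φ, α => ¬ φ.Realize A α
  | conj _ φ, α => ∀ i, (φ i).Realize A α
  | disj _ φ, α => ∃ i, (φ i).Realize A α
  | ex i φ, α => ∃ a, φ.Realize A (Function.update α i a)
  | all i φ, α => ∀ a, φ.Realize A (Function.update α i a)
  | quant Q _ y ψ, α =>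
      (⟨A.carrier,
        structureOfRel Q.finRelational
          (fun n R b => (ψ n R).Realize A (updateTuple α (y n R) b)),
        A.finite, A.nonempty⟩ : FinStr Q.voc) ∈ Q.cls

/-- `A ⊨ φ`; used for sentences, whose truth does not depend on the assignment. -/
def FinStr.Models {σ : FirstOrder.Language.{0, 0}} {𝒬 : Set Quantifier} {k : ℕ} (A : FinStr σ)
    (φ : Formula σ 𝒬 k) : Prop :=
  ∀ α : Fin k → A.carrier, φ.Realize A α

/-- The class `K` of finite `σ`-structures is defined by a sentence of `ℒ(𝒬)`, where
`ℒ(𝒬)` is the union of the `k`-variable logics over all `k`. -/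
def DefinableIn {σ : FirstOrder.Language.{0, 0}} (𝒬 : Set Quantifier) (K : Set (FinStr σ)) : Prop :=
  ∃ (k : ℕ) (ψ : Formula σ 𝒬 k), ψ.IsSentence ∧ ∀ A : FinStr σ, A.Models ψ ↔ A ∈ K

/-- `ℒ(𝒬) ≤ ℒ(𝒬')`: every sentence of `ℒ(𝒬)`, over any finite relational vocabulary, is
equivalent (on finite structures) to a sentence of `ℒ(𝒬')`. -/
def LogicLE (𝒬 𝒬' : Set Quantifier) : Prop :=
  ∀ (σ : FirstOrder.Language.{0, 0}), FinRelational σ → ∀ (k : ℕ) (φ : Formula σ 𝒬 k), φ.IsSentence →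
    DefinableIn 𝒬' {A : FinStr σ | A.Models φ}

/-! ### Partial polymorphisms and CSP quantifiers -/

/-- The relation `p(R)`, obtained by applying the partial function `p` columnwise. -/
def applyColumns {A : Type} {ℓ n : ℕ} (p : (Fin ℓ → A) →. A) (R : Set (Fin n → A)) :
    Set (Fin n → A) :=
  {c | ∃ a : Fin ℓ → (Fin n → A), (∀ i, a i ∈ R) ∧ ∀ j, c j ∈ p (fun i => a i j)}

/-- `p` is a partial polymorphism of the structure on `A`. -/
def IsPartialPolymorphism (τ : FirstOrder.Language.{0, 0}) {A : Type} [τ.Structure A] {ℓ : ℕ}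
    (p : (Fin ℓ → A) →. A) : Prop :=
  ∀ (n : ℕ) (R : τ.Relations n),
    applyColumns p {x | FirstOrder.Language.Structure.RelMap R x} ⊆ {x | FirstOrder.Language.Structure.RelMap R x}

/-- `Q` is closed under the family `p` of partial functions: whenever `B` is in its class and
`S` is a structure on the universe of `B` with `S ≤ B ∪ p(B)`, also `S` is in the class. -/
def Quantifier.ClosedUnder (Q : Quantifier) {ℓ : ℕ} (p : ∀ A : Type, (Fin ℓ → A) →. A) : Prop :=
  ∀ B ∈ Q.cls, ∀ S : Q.voc.Structure B.carrier,
    (∀ (n : ℕ) (R : Q.voc.Relations n),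
      {x | S.RelMap R x} ⊆ {x | B.str.RelMap R x} ∪
        applyColumns (p B.carrier) {x | B.str.RelMap R x}) →
    (⟨B.carrier, S, B.finite, B.nonempty⟩ : FinStr Q.voc) ∈ Q.cls

/-- The `ℓ`-ary partial near-unanimity function: its value is `a` if at least `ℓ - 1` of the
arguments are equal to `a`, and it is undefined if there is no such `a`. -/
noncomputable def nearUnanimity (ℓ : ℕ) (A : Type) : (Fin ℓ → A) →. A :=
  fun x => ⟨∃ a, ℓ - 1 ≤ {i | x i = a}.ncard, fun h => h.choose⟩

theorem mem_nearUnanimity {ℓ : ℕ} (hℓ : 3 ≤ ℓ) {A : Type} (x : Fin ℓ → A) (a : A) :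
    a ∈ nearUnanimity ℓ A x ↔ ℓ - 1 ≤ {i | x i = a}.ncard := by
  have uniq : ∀ a b : A, ℓ - 1 ≤ {i | x i = a}.ncard → ℓ - 1 ≤ {i | x i = b}.ncard → a = b := by
    intro a b ha hb
    by_contra hab
    have hd : Disjoint {i | x i = a} {i | x i = b} := by
      rw [Set.disjoint_left]
      intro i hi hi'
      exact hab (hi.symm.trans hi')
    have h1 := Set.ncard_union_eq hd (Set.toFinite _) (Set.toFinite _)
    have h2 := Set.ncard_le_card ({i | x i = a} ∪ {i | x i = b})
    rw [Nat.card_eq_fintype_card, Fintype.card_fin] at h2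
    omega
  constructor
  · rintro ⟨h, rfl⟩
    exact h.choose_spec
  · intro h
    have h' : ∃ a, ℓ - 1 ≤ {i | x i = a}.ncard := ⟨a, h⟩
    exact ⟨h', uniq _ _ h'.choose_spec h⟩

/-- The CSP quantifier with template `B`; its class consists of all finite structures that map
homomorphically to `B`. -/
def cspQuantifier {τ : FirstOrder.Language.{0, 0}} (h : FinRelational τ) (B : FinStr τ) : Quantifier where
  voc := τ
  finRelational := h
  cls := {A | A.MapsTo B}
  iso_closed := by
    rintro A A' ⟨e⟩ ⟨f⟩
    exact ⟨f.comp e.symm.toHom⟩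

/-- `Q` is a CSP quantifier. -/
def Quantifier.IsCSP (Q : Quantifier) : Prop :=
  ∃ B : FinStr Q.voc, Q.cls = {A | A.MapsTo B}

/-- The collection of all CSP quantifiers of arity at most `r` that are closed under the `ℓ`-ary
partial near-unanimity functions. -/
def nearUnanimityCSPQuantifiers (ℓ r : ℕ) : Set Quantifier :=
  {Q | Q.IsCSP ∧ Q.ClosedUnder (nearUnanimity ℓ) ∧ Q.ArityLE r}

/-! ### The bijection game -/

section Game

variable {τ : FirstOrder.Language.{0, 0}}

/-- A position `(α, β)`: two partial assignments with the same domain, where the variable `v` is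
in the domain if the value at `v` is `some (α v, β v)`. -/
abbrev GamePosition (A B : FinStr τ) (k : ℕ) : Type := Fin k → Option (A.carrier × B.carrier)

/-- The map `α v ↦ β v` is a partial isomorphism from `A` to `B`. -/
def GamePosition.IsPartialIso {A B : FinStr τ} {k : ℕ} (p : GamePosition A B k) : Prop :=
  (∀ (v w : Fin k) (a a' : A.carrier) (b b' : B.carrier),
    p v = some (a, b) → p w = some (a', b') → (a = a' ↔ b = b')) ∧
  ∀ (n : ℕ) (R : τ.Relations n) (x : Fin n → Fin k) (a : Fin n → A.carrier)
    (b : Fin n → B.carrier), (∀ i, p (x i) = some (a i, b i)) →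
      (FirstOrder.Language.Structure.RelMap R a ↔ FirstOrder.Language.Structure.RelMap R b)

/-- A move of Spoiler: an `r`-tuple of distinct variables and an `r`-tuple of elements of `A`. -/
structure SpoilerMove (A : FinStr τ) (k r : ℕ) where
  vars : Fin r ↪ Fin k
  elems : Fin r → A.carrier

/-- The position reached after the given moves of Spoiler (most recent move first), if
Duplicator plays the bijection `s h` after the history `h`. -/
noncomputable def gamePosition {A B : FinStr τ} {k r : ℕ}
    (s : List (SpoilerMove A k r) → (A.carrier ≃ B.carrier)) :
    List (SpoilerMove A k r) → GamePosition A B k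
  | [] => fun _ => none
  | m :: h => updateTuple (gamePosition s h) m.vars
      (fun i => some (m.elems i, s h (m.elems i)))

/-- Duplicator has a winning strategy in the `k,r`-bijection game on `A` and `B`: a choice of
bijections, depending on the history, such that after every round the position is a partial
isomorphism. -/
def DuplicatorWins (k r : ℕ) (A B : FinStr τ) : Prop :=
  ∃ s : List (SpoilerMove A k r) → (A.carrier ≃ B.carrier),
    ∀ (h : List (SpoilerMove A k r)) (m : SpoilerMove A k r),
      (gamePosition s (m :: h)).IsPartialIso

end Game

/-! Quantifiers of arity at most `r` cannot separate structures on which Duplicator wins the game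
with `r`-tuples: her bijection is fixed before Spoiler picks a tuple, so it is an isomorphism
between the structures interpreted by a quantifier (`realize_iff_of_strategy`). What is needed is a
closed template with game-indistinguishable instances. Put ℓ = q + 3.

The template encodes a linear equation over ℤ₃ in q + 3 variables: two consecutive chain variables
and q + 1 links. This equation alone is not preserved by n^ℓ, since each of the ℓ rows can deviate
in its own column. The extra slope coordinate, which completes the chain values to an arithmetic
progression, repairs this (`applyColumns_linRel`).

The instances are lifts, in the style of Cai, Fürer and Immerman, of a system of such equations on a
bipartite graph of hubs. Every link occurs in one row and one column and the chains telescope, so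
the right-hand sides must have equal sums over rows and over columns; a single 1 violates this
(`not_mapsTo_template`). Duplicator shifts the fibres by an assignment that fails at one row vertex
only. Before each move of Spoiler she transports this error, without touching pebbled variables, to
a place with no pebbles around it (`canMove_of_free_hubStar`). Spoiler then places at most q + 2 = ℓ
- 1 new pebbles, whereas trapping the error takes q + 3: two to freeze the row cycle and one for
each of the q + 1 columns linked to the vertex (`exists_escape`). -/

/-! ### Bijection games and quantifiers of bounded arity -/

theorem updateTuple_eq_ite {A : Type} {k n : ℕ} (α : Fin k → A) (y : Fin n ↪ Fin k)
    (b : Fin n → A) {v : Fin k} {c : A} (h : updateTuple α y b v = c) :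
    (∃ i, y i = v ∧ b i = c) ∨ (v ∉ Set.range y ∧ α v = c) := by
  by_cases hv : v ∈ Set.range y
  · obtain ⟨i, rfl⟩ := hv
    rw [updateTuple_apply] at h
    exact Or.inl ⟨i, rfl, h⟩
  · rw [updateTuple_of_notMem _ _ _ _ hv] at h
    exact Or.inr ⟨hv, h⟩

/-- The one-element tuple of variables `i`. -/
def singleVar {k : ℕ} (i : Fin k) : Fin 1 ↪ Fin k := ⟨fun _ => i, fun _ _ _ => Subsingleton.elim _ _⟩

theorem range_singleVar {k : ℕ} (i : Fin k) : Set.range (singleVar i) = {i} := by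
  ext v
  exact ⟨fun ⟨_, h⟩ => h.symm, fun h => ⟨0, h.symm⟩⟩

theorem update_eq_updateTuple {A : Type} {k : ℕ} (α : Fin k → A) (i : Fin k) (a : A) :
    Function.update α i a = updateTuple α (singleVar i) (fun _ => a) := by
  funext v
  by_cases hv : v = i
  · subst hv
    have := updateTuple_apply α (singleVar v) (fun _ => a) 0
    rw [Function.update_self]
    exact this.symm
  · rw [Function.update_of_ne hv, updateTuple_of_notMem]
    rintro ⟨_, h⟩
    exact hv h.symm

/-- Extend a tuple of variables by fresh dummy variables. -/
def padVars {n k r : ℕ} (y : Fin n ↪ Fin k) : Fin r ↪ Fin (k + r) where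
  toFun j := if h : j.val < n then Fin.castAdd r (y ⟨j, h⟩) else Fin.natAdd k j
  inj' := by
    intro i j hij
    by_cases hi : i.val < n <;> by_cases hj : j.val < n <;> simp only [hi, hj, dite_true, dite_false] at hij
    · have := y.injective (Fin.castAdd_injective _ _ hij)
      simpa [Fin.ext_iff] using this
    · have h1 := congrArg Fin.val hij
      have h2 := (y ⟨i, hi⟩).isLt
      simp at h1; omega
    · have h1 := congrArg Fin.val hij
      have h2 := (y ⟨j, hj⟩).isLt
      simp at h1; omega
    · have h1 := congrArg Fin.val hij
      simp at h1; omega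

theorem padVars_of_lt {n k r : ℕ} (y : Fin n ↪ Fin k) {j : Fin r} (h : j.val < n) :
    padVars y j = Fin.castAdd r (y ⟨j, h⟩) := dif_pos h

theorem padVars_of_not_lt {n k r : ℕ} (y : Fin n ↪ Fin k) {j : Fin r} (h : ¬ j.val < n) :
    padVars y j = Fin.natAdd k j := dif_neg h

/-- The move in which Spoiler assigns `b` to `y`, padded to an `r`-tuple. -/
noncomputable def padMove {σ : FirstOrder.Language.{0, 0}} {A : FinStr σ} {n k r : ℕ}
    (y : Fin n ↪ Fin k) (b : Fin n → A.carrier) : SpoilerMove A (k + r) r where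
  vars := padVars y
  elems j := if h : j.val < n then b ⟨j, h⟩ else Classical.choice A.nonempty

theorem gamePosition_padMove {σ : FirstOrder.Language.{0, 0}} {A B : FinStr σ} {n k r : ℕ}
    (hn : n ≤ r) (s : List (SpoilerMove A (k + r) r) → (A.carrier ≃ B.carrier))
    (h : List (SpoilerMove A (k + r) r)) (y : Fin n ↪ Fin k) (b : Fin n → A.carrier)
    (α : Fin k → A.carrier) (β : Fin k → B.carrier) (S : Set (Fin k))
    (hS : ∀ v ∈ S \ Set.range y, gamePosition s h (Fin.castAdd r v) = some (α v, β v)) :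
    ∀ v ∈ S, gamePosition s (padMove y b :: h) (Fin.castAdd r v) =
      some (updateTuple α y b v, updateTuple β y (fun i => s h (b i)) v) := by
  intro v hv
  by_cases hy : v ∈ Set.range y
  · obtain ⟨i, rfl⟩ := hy
    have e : Fin.castAdd r (y i) = (padVars y : Fin r ↪ Fin (k + r)) ⟨i, i.isLt.trans_le hn⟩ :=
      (padVars_of_lt (j := ⟨i, i.isLt.trans_le hn⟩) y i.isLt).symm
    rw [updateTuple_apply, updateTuple_apply, e]
    refine (updateTuple_apply (gamePosition s h) (padVars y) _ _).trans ?_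
    simp [padMove]
  · rw [updateTuple_of_notMem _ _ _ _ hy, updateTuple_of_notMem _ _ _ _ hy]
    refine (updateTuple_of_notMem (gamePosition s h) (padVars y) _ _ ?_).trans (hS v ⟨hv, hy⟩)
    rintro ⟨j, hj⟩
    by_cases hjn : j.val < n
    · rw [padVars_of_lt y hjn] at hj
      exact hy ⟨_, Fin.castAdd_injective _ _ hj⟩
    · rw [padVars_of_not_lt y hjn] at hj
      have h1 := congrArg Fin.val hj
      have h2 := v.isLt
      simp at h1; omega

theorem isPartialIso_gamePosition {σ : FirstOrder.Language.{0, 0}} {A B : FinStr σ} {k r : ℕ}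
    {s : List (SpoilerMove A (k + r) r) → (A.carrier ≃ B.carrier)}
    (hs : ∀ h m, (gamePosition s (m :: h)).IsPartialIso) (h : List (SpoilerMove A (k + r) r)) :
    (gamePosition s h).IsPartialIso := by
  cases h with
  | cons m h => exact hs h m
  | nil =>
    refine ⟨fun v w a a' b b' h => by simp [gamePosition] at h, ?_⟩
    intro n R x a b hx
    cases n with
    | succ n => have := hx 0; simp [gamePosition] at this
    | zero =>
      -- Nullary relations are compared only after a round, so an arbitrary move on the dummy
      -- variables is played.
      exact (hs [] ⟨Fin.natAddEmb k, fun _ => Classical.choice A.nonempty⟩).2 0 R x a b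
        (fun i => i.elim0)

/-- Induction on the formula, with the history of the game arbitrary. The `r` additional game
variables let a quantifier that binds fewer than `r` variables be simulated by a full move of
Spoiler. -/
theorem realize_iff_of_strategy {σ : FirstOrder.Language.{0, 0}} {𝒬 : Set Quantifier}
    {A B : FinStr σ} {k r : ℕ} (hr : 1 ≤ r) (h𝒬 : ∀ Q ∈ 𝒬, Q.ArityLE r)
    {s : List (SpoilerMove A (k + r) r) → (A.carrier ≃ B.carrier)}
    (hs : ∀ h m, (gamePosition s (m :: h)).IsPartialIso) (φ : Formula σ 𝒬 k) :
    ∀ (h : List (SpoilerMove A (k + r) r)) (α : Fin k → A.carrier) (β : Fin k → B.carrier),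
      (∀ v ∈ φ.freeVars, gamePosition s h (Fin.castAdd r v) = some (α v, β v)) →
      (φ.Realize A α ↔ φ.Realize B β) := by
  have one : ∀ (φ : Formula σ 𝒬 k) (i : Fin k),
      (∀ (h : List (SpoilerMove A (k + r) r)) (α : Fin k → A.carrier) (β : Fin k → B.carrier),
        (∀ v ∈ φ.freeVars, gamePosition s h (Fin.castAdd r v) = some (α v, β v)) →
        (φ.Realize A α ↔ φ.Realize B β)) →
      ∀ (h : List (SpoilerMove A (k + r) r)) (α : Fin k → A.carrier) (β : Fin k → B.carrier),
      (∀ v ∈ φ.freeVars \ {i}, gamePosition s h (Fin.castAdd r v) = some (α v, β v)) →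
      ∀ a, (φ.Realize A (Function.update α i a) ↔ φ.Realize B (Function.update β i (s h a))) := by
    intro φ i ih h α β hp a
    rw [update_eq_updateTuple, update_eq_updateTuple]
    refine ih (padMove (singleVar i) (fun _ => a) :: h) _ _
      (gamePosition_padMove hr s h (singleVar i) (fun _ => a) α β _ ?_)
    rwa [range_singleVar]
  induction φ with
  | eq i j =>
    intro h α β hp
    exact (isPartialIso_gamePosition hs h).1 _ _ _ _ _ _
      (hp i (by simp [Formula.freeVars])) (hp j (by simp [Formula.freeVars]))
  | rel n R x =>
    intro h α β hp
    exact (isPartialIso_gamePosition hs h).2 n R (fun i => Fin.castAdd r (x i)) _ _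
      (fun i => hp (x i) ⟨i, rfl⟩)
  | neg φ ih => intro h α β hp; exact not_congr (ih h α β hp)
  | conj ι φ ih =>
    intro h α β hp
    exact forall_congr' fun i => ih i h α β fun v hv => hp v (Set.mem_iUnion.2 ⟨i, hv⟩)
  | disj ι φ ih =>
    intro h α β hp
    exact exists_congr fun i => ih i h α β fun v hv => hp v (Set.mem_iUnion.2 ⟨i, hv⟩)
  | ex i φ ih =>
    intro h α β hp
    exact (s h).exists_congr (one φ i ih h α β hp)
  | all i φ ih =>
    intro h α β hp
    exact (s h).forall_congr (fun {a} => one φ i ih h α β hp a)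
  | quant Q hQ y ψ ih =>
    intro h α β hp
    have key : ∀ n (R : Q.voc.Relations n) (b : Fin n → A.carrier),
        (ψ n R).Realize A (updateTuple α (y n R) b) ↔
          (ψ n R).Realize B (updateTuple β (y n R) (fun i => s h (b i))) := by
      intro n R b
      refine ih n R (padMove (y n R) b :: h) _ _
        (gamePosition_padMove (h𝒬 Q hQ n ⟨R⟩) s h (y n R) b α β _ ?_)
      intro v hv
      exact hp v (Set.mem_iUnion.2 ⟨n, Set.mem_iUnion.2 ⟨R, hv⟩⟩)
    let SA : Q.voc.Structure A.carrier := structureOfRel Q.finRelational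
      (fun n R b => (ψ n R).Realize A (updateTuple α (y n R) b))
    let SB : Q.voc.Structure B.carrier := structureOfRel Q.finRelational
      (fun n R b => (ψ n R).Realize B (updateTuple β (y n R) b))
    let e : @FirstOrder.Language.Equiv Q.voc A.carrier B.carrier SA SB :=
      @FirstOrder.Language.Equiv.mk Q.voc A.carrier B.carrier SA SB (s h)
        (fun {n} f _ => ((Q.finRelational.relational n).false f).elim)
        (fun {n} R b => (key n R b).symm)
    exact ⟨fun H => Q.iso_closed ⟨A.carrier, SA, A.finite, A.nonempty⟩
        ⟨B.carrier, SB, B.finite, B.nonempty⟩ ⟨e⟩ H,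
      fun H => Q.iso_closed ⟨B.carrier, SB, B.finite, B.nonempty⟩
        ⟨A.carrier, SA, A.finite, A.nonempty⟩
        ⟨@FirstOrder.Language.Equiv.symm Q.voc A.carrier B.carrier SA SB e⟩ H⟩

theorem not_definableIn_of_duplicatorWins {σ : FirstOrder.Language.{0, 0}} {r : ℕ} (hr : 1 ≤ r)
    {K : Set (FinStr σ)}
    (hK : ∀ k, r ≤ k → ∃ A A' : FinStr σ, A ∈ K ∧ A' ∉ K ∧ DuplicatorWins k r A A') :
    ¬ DefinableIn (quantifiersOfArity r) K := by
  rintro ⟨k, ψ, hψ, hdef⟩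
  obtain ⟨A, A', hA, hA', s, hs⟩ := hK (k + r) (Nat.le_add_left r k)
  apply hA'
  rw [← hdef]
  intro β
  have α : Fin k → A.carrier := fun _ => Classical.choice A.nonempty
  refine (realize_iff_of_strategy (𝒬 := quantifiersOfArity r) hr (fun Q hQ => hQ) hs ψ [] α β ?_).1 ((hdef A).2 hA α)
  intro v hv
  exact ((Set.ext_iff.1 hψ v).1 hv).elim

open Classical in
/-- Duplicator wins if every position with the invariant `I` admits a bijection which preserves
it. -/
theorem duplicatorWins_of_invariant {σ : FirstOrder.Language.{0, 0}} {A B : FinStr σ} {k r : ℕ}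
    (I : GamePosition A B k → Prop) (hI : I (fun _ => none)) (hiso : ∀ p, I p → p.IsPartialIso)
    (hstep : ∀ p, I p → ∃ f : A.carrier ≃ B.carrier, ∀ m : SpoilerMove A k r,
      I (updateTuple p m.vars (fun i => some (m.elems i, f (m.elems i))))) :
    DuplicatorWins k r A B := by
  obtain ⟨f₀, -⟩ := hstep _ hI
  -- Positions without the invariant never arise; `f₀` is only a default there.
  let F : GamePosition A B k → (A.carrier ≃ B.carrier) := fun p =>
    if h : I p then (hstep p h).choose else f₀
  let pos : List (SpoilerMove A k r) → GamePosition A B k := fun h =>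
    h.foldr (fun m p => updateTuple p m.vars (fun i => some (m.elems i, F p (m.elems i))))
      (fun _ => none)
  have hpos : ∀ h, gamePosition (fun h => F (pos h)) h = pos h := by
    intro h
    induction h with
    | nil => rfl
    | cons m h ih => simp only [gamePosition, ih]; rfl
  have hIpos : ∀ h, I (pos h) := by
    intro h
    induction h with
    | nil => exact hI
    | cons m h ih =>
      have := (hstep _ ih).choose_spec m
      have e : F (pos h) = (hstep _ ih).choose := dif_pos ih
      rw [← e] at this
      exact this
  exact ⟨fun h => F (pos h), fun h m => hiso _ (by rw [hpos]; exact hIpos _)⟩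

/-! ### Closed CSP quantifiers -/

/-- Near unanimity commutes with every map: arguments that agree still agree after applying `g`.
Hence the same `g` remains a homomorphism on the enlarged relations. -/
theorem closedUnder_nearUnanimity_cspQuantifier {τ : FirstOrder.Language.{0, 0}}
    (hτ : FinRelational τ) {ℓ : ℕ} (hℓ : 3 ≤ ℓ) (B : FinStr τ)
    (hB : IsPartialPolymorphism τ (nearUnanimity ℓ B.carrier)) :
    (cspQuantifier hτ B).ClosedUnder (nearUnanimity ℓ) := by
  suffices main : ∀ A : FinStr τ, A.MapsTo B → ∀ S : τ.Structure A.carrier,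
      (∀ (n : ℕ) (R : τ.Relations n), {x | S.RelMap R x} ⊆ {x | A.str.RelMap R x} ∪
        applyColumns (nearUnanimity ℓ A.carrier) {x | A.str.RelMap R x}) →
      (⟨A.carrier, S, A.finite, A.nonempty⟩ : FinStr τ).MapsTo B from main
  rintro A ⟨f⟩
  obtain ⟨g, hg⟩ : ∃ g : A.carrier → B.carrier, ∀ (n : ℕ) (R : τ.Relations n)
      (x : Fin n → A.carrier), A.str.RelMap R x → B.str.RelMap R (g ∘ x) :=
    ⟨f, fun _ R x => f.map_rel' R x⟩
  intro S hS
  let f' : @FirstOrder.Language.Hom τ A.carrier B.carrier S B.str :=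
    @FirstOrder.Language.Hom.mk τ A.carrier B.carrier S B.str g
      (fun {n} c _ => ((hτ.relational n).false c).elim) ?_
  · exact ⟨f'⟩
  intro n R x hx
  rcases hS n R hx with h | ⟨a, ha, hc⟩
  · exact hg n R x h
  · refine hB n R ⟨fun i => g ∘ a i, fun i => hg n R _ (ha i), fun j => ?_⟩
    rw [mem_nearUnanimity hℓ]
    refine ((mem_nearUnanimity hℓ _ _).1 (hc j)).trans (Set.ncard_le_ncard ?_ (Set.toFinite _))
    intro i hi
    exact congrArg g hi

/-- The columnwise form of near unanimity: in every column all rows but one have the value. -/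
theorem exists_row_of_mem_nearUnanimity {ℓ : ℕ} (hℓ : 3 ≤ ℓ) {A : Type} {x : Fin ℓ → A} {a : A}
    (h : a ∈ nearUnanimity ℓ A x) : ∃ i₀, ∀ i, i ≠ i₀ → x i = a := by
  rw [mem_nearUnanimity hℓ] at h
  have hc := Set.ncard_add_ncard_compl {i | x i = a}
  rw [Nat.card_eq_fintype_card, Fintype.card_fin] at hc
  have h1 : {i | x i = a}ᶜ.ncard ≤ 1 := by omega
  rw [Set.ncard_le_one] at h1
  by_cases hne : {i | x i = a}ᶜ.Nonempty
  · obtain ⟨i₀, hi₀⟩ := hne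
    exact ⟨i₀, fun i hi => by_contra fun hx => hi (h1 i hx i₀ hi₀)⟩
  · exact ⟨⟨0, by omega⟩, fun i _ => by_contra fun hx => hne ⟨i, hx⟩⟩

/-- A sentence defining the class of a quantifier in the logic with that quantifier. -/
theorem definableIn_cls {Q : Quantifier} {𝒬 : Set Quantifier} (hQ : Q ∈ 𝒬) {r : ℕ}
    (hr : Q.ArityLE r) : ∃ φ : Formula Q.voc 𝒬 r, φ.IsSentence ∧
      ∀ A : FinStr Q.voc, A.Models φ ↔ A ∈ Q.cls := by
  refine ⟨.quant Q hQ (fun n R => Fin.castLEEmb (hr n ⟨R⟩))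
    (fun n R => .rel n R (Fin.castLE (hr n ⟨R⟩))), ?_, ?_⟩
  · simp only [Formula.IsSentence, Formula.freeVars, Set.iUnion_eq_empty]
    intro n R
    rw [Set.sdiff_eq_empty]
    rintro _ ⟨i, rfl⟩
    exact ⟨i, rfl⟩
  · intro A
    have key : ∀ α : Fin r → A.carrier, (structureOfRel Q.finRelational
        (fun n R b => (Formula.rel (𝒬 := 𝒬) n R (Fin.castLE (hr n ⟨R⟩))).Realize A
          (updateTuple α (Fin.castLEEmb (hr n ⟨R⟩)) b)) : Q.voc.Structure A.carrier) = A.str := by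
      intro α
      refine FirstOrder.Language.Structure.ext ?_ ?_
      · funext n f
        exact ((Q.finRelational.relational n).false f).elim
      · funext n R b
        exact congrArg (A.str.RelMap R)
          (funext fun i => updateTuple_apply α (Fin.castLEEmb (hr n ⟨R⟩)) b i)
    constructor
    · intro h
      have α : Fin r → A.carrier := fun _ => Classical.choice A.nonempty
      have := h α
      simp only [Formula.Realize] at this
      have e := key α
      simp only [Formula.Realize] at e
      rw [e] at this
      exact this
    · intro h α
      have e := key α
      simp only [Formula.Realize] at e ⊢
      rw [e]
      exact h

/-! ### The template -/

/-- The symbols of the vocabulary of the template: one for a system of two linear equations and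
one for the cyclic successor. -/
inductive TemplateRel (q : ℕ) : ℕ → Type
  | lin : TemplateRel q (q + 4)
  | succ : TemplateRel q (q + 4)

/-- The vocabulary of the template. -/
def templateVoc (q : ℕ) : FirstOrder.Language.{0, 0} := ⟨fun _ => Empty, TemplateRel q⟩

theorem finRelational_templateVoc (q : ℕ) : FinRelational (templateVoc q) where
  relational := fun _ => inferInstanceAs (IsEmpty Empty)
  finite_relations := by
    refine Finite.of_surjective
      (fun b : Bool => (⟨q + 4, if b then .lin else .succ⟩ : Σ n, TemplateRel q n)) ?_
    rintro ⟨_, _ | _⟩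
    · exact ⟨true, rfl⟩
    · exact ⟨false, rfl⟩

/-- The linear form which carries the right-hand sides. -/
def weight {q : ℕ} (y : Fin (q + 4) → ZMod 3) : ZMod 3 :=
  (∑ m : Fin (q + 1), y m.succ.succ.succ) + (y 1 - y 2)

theorem weight_add {q : ℕ} (y z : Fin (q + 4) → ZMod 3) :
    weight (fun i => y i + z i) = weight y + weight z := by
  simp only [weight, Finset.sum_add_distrib]; ring

theorem weight_smul {q : ℕ} (c : ZMod 3) (y : Fin (q + 4) → ZMod 3) :
    weight (fun i => c * y i) = c * weight y := by
  simp only [weight, ← Finset.mul_sum]; ring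

/-- The solutions of the two equations: the first three entries are in arithmetic progression,
and the weight is `c`. -/
def linRel (q : ℕ) (c : ZMod 3) : Set (Fin (q + 4) → ZMod 3) :=
  {y | y 0 + y 1 + y 2 = 0 ∧ weight y = c}

/-- The graph of the cyclic successor, with the second entry repeated. -/
def succRel (q : ℕ) : Set (Fin (q + 4) → ZMod 3) :=
  {y | ∀ i : Fin (q + 3), y i.succ = y 0 + 1}

/-- The template structure on `ℤ₃`. -/
@[reducible] def templateStructure (q : ℕ) : (templateVoc q).Structure (ZMod 3) :=
  structureOfRel (finRelational_templateVoc q) (fun _ R => match R with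
    | .lin => fun y => y ∈ linRel q 0
    | .succ => fun y => y ∈ succRel q)

/-- Two rows agree with `c` on all links, so they have the same difference of entries 1 and 2. In
characteristic 3 the progression equation then makes their first three entries differ by a constant.
If the constant is zero, both rows agree with `c` there. Otherwise one of them deviates in each of
these columns, so any third row equals `c` there and `c` satisfies the first equation. One of the
two rows agrees with `c` in two of the three columns, hence in the third as well. -/
theorem applyColumns_linRel (q : ℕ) :
    applyColumns (nearUnanimity (q + 3) (ZMod 3)) (linRel q 0) ⊆ linRel q 0 := by
  rintro c ⟨a, ha, hc⟩
  choose r hr using fun j => exists_row_of_mem_nearUnanimity (by omega) (hc j)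
  -- The rows that deviate in no link column; at least (q + 3) - (q + 1) = 2 remain.
  let S : Finset (Fin (q + 3)) :=
    (Finset.univ.image fun m : Fin (q + 1) => r m.succ.succ.succ)ᶜ
  have hS : 1 < S.card := by
    have h1 := Finset.card_image_le (s := Finset.univ)
      (f := fun m : Fin (q + 1) => r m.succ.succ.succ)
    rw [Finset.card_univ, Fintype.card_fin] at h1
    rw [Finset.card_compl, Fintype.card_fin]
    omega
  obtain ⟨i₁, hi₁, i₂, hi₂, hne⟩ := Finset.one_lt_card.1 hS
  have hx : ∀ i ∈ S, (∑ m : Fin (q + 1), a i m.succ.succ.succ) =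
      ∑ m : Fin (q + 1), c m.succ.succ.succ := by
    intro i hi
    refine Finset.sum_congr rfl fun m _ => hr _ _ ?_
    rintro rfl
    simp [S] at hi
  obtain ⟨i₃, h31, h32⟩ : ∃ i₃, i₃ ≠ i₁ ∧ i₃ ≠ i₂ := by
    have : ∃ i₃, i₃ ∉ ({i₁, i₂} : Finset (Fin (q + 3))) := by
      by_contra! hcon
      have h1 := Finset.card_le_card (fun x (_ : x ∈ Finset.univ) => hcon x)
      have h2 := Finset.card_le_two (a := i₁) (b := i₂)
      rw [Finset.card_univ, Fintype.card_fin] at h1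
      omega
    simpa using this
  have e1 := ha i₁
  have e2 := ha i₂
  have e3 := (ha i₃).1
  simp only [linRel, weight, Set.mem_ofPred_eq] at e1 e2 ⊢
  rw [hx i₁ hi₁] at e1
  rw [hx i₂ hi₂] at e2
  have r0 := hr 0
  have r1 := hr 1
  have r2 := hr 2
  grind

/-- A tuple is determined by any one of its entries. Two different rows differ in every column, so
they absorb all deviations and any third row equals `c`; if all rows coincide, `c` is that row. -/
theorem applyColumns_succRel (q : ℕ) :
    applyColumns (nearUnanimity (q + 3) (ZMod 3)) (succRel q) ⊆ succRel q := by
  rintro c ⟨a, ha, hc⟩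
  choose r hr using fun j => exists_row_of_mem_nearUnanimity (by omega) (hc j)
  by_cases h : ∃ i i', a i 0 ≠ a i' 0
  · obtain ⟨i, i', hne⟩ := h
    obtain ⟨i'', h1, h2⟩ : ∃ i'', i'' ≠ i ∧ i'' ≠ i' := by
      have : ∃ i₃, i₃ ∉ ({i, i'} : Finset (Fin (q + 3))) := by
        by_contra! hcon
        have h1 := Finset.card_le_card (fun x (_ : x ∈ Finset.univ) => hcon x)
        have h2 := Finset.card_le_two (a := i) (b := i')
        rw [Finset.card_univ, Fintype.card_fin] at h1
        omega
      simpa using this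
    have hdiff : ∀ j, a i j ≠ a i' j := by
      intro j
      refine Fin.cases hne (fun j => ?_) j
      rw [ha i j, ha i' j]
      simpa using hne
    have hj : ∀ j, a i'' j = c j := by
      intro j
      refine hr j _ fun h3 => hdiff j ?_
      rw [hr j i (by rintro rfl; exact h1 h3), hr j i' (by rintro rfl; exact h2 h3)]
    intro j
    rw [← hj, ← hj, ha i'']
  · push Not at h
    have hj : ∀ j, c j = a 0 j := by
      intro j
      obtain ⟨i, hi⟩ := exists_ne (r j)
      rw [← hr j i hi]
      refine Fin.cases (h _ _) (fun j => ?_) j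
      rw [ha i j, ha 0 j, h]
    intro j
    rw [hj, hj, ha 0]

theorem isPartialPolymorphism_template (q : ℕ) :
    @IsPartialPolymorphism (templateVoc q) (ZMod 3) (templateStructure q) (q + 3)
      (nearUnanimity (q + 3) (ZMod 3)) := by
  rintro n (_ | _)
  · exact applyColumns_linRel q
  · exact applyColumns_succRel q

/-! ### The system of equations

Two families of hubs (rows and columns) form a complete bipartite graph. The large degree of a hub
is distributed over a cycle of vertices, each of which has `q + 1` links to hubs of the other
family. -/

/-- The hubs of one of the two families. -/
abbrev Hub (q k : ℕ) : Type := ZMod (k + 1) × Fin (q + 1)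

/-- The vertices `(s, g, j)`: the vertex with number `j` on the cycle of the hub `g`, which is a row
if `s = false` and a column if `s = true`. -/
abbrev Vert (q k : ℕ) : Type := Bool × Hub q k × ZMod (k + 1)

/-- The variables: the links between rows and columns, the edges of the cycles, and a variable for
each vertex. -/
inductive Var (q k : ℕ) : Type
  | link (g h : Hub q k) : Var q k
  | chain (v : Vert q k) : Var q k
  | slope (v : Vert q k) : Var q k

variable {q k : ℕ}

instance : Finite (Var q k) := by
  refine Finite.of_surjective (α := (Hub q k × Hub q k) ⊕ Vert q k ⊕ Vert q k) (fun x => match x with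
    | .inl (g, h) => .link g h
    | .inr (.inl v) => .chain v
    | .inr (.inr v) => .slope v) ?_
  rintro (⟨g, h⟩ | v | v)
  · exact ⟨.inl (g, h), rfl⟩
  · exact ⟨.inr (.inl v), rfl⟩
  · exact ⟨.inr (.inr v), rfl⟩

instance : Nonempty (Var q k) := ⟨.link (0, 0) (0, 0)⟩

/-- The links at a vertex. -/
def Vert.links : Vert q k → Fin (q + 1) → Var q k
  | (false, g, j), m => .link g (j, m)
  | (true, h, i), m => .link (i, m) h

/-- The next vertex on the cycle. -/
def Vert.next (v : Vert q k) : Vert q k := (v.1, v.2.1, v.2.2 + 1)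

/-- The variables in the equations at a vertex. -/
def Vert.scope (v : Vert q k) : Fin (q + 4) → Var q k :=
  Matrix.vecCons (.slope v) (Matrix.vecCons (.chain v) (Matrix.vecCons (.chain v.next) v.links))

theorem Vert.scope_zero (v : Vert q k) : v.scope 0 = .slope v := rfl

theorem Vert.scope_one (v : Vert q k) : v.scope 1 = .chain v := rfl

theorem Vert.scope_two (v : Vert q k) : v.scope 2 = .chain v.next := rfl

theorem weight_scope (σ : Var q k → ZMod 3) (v : Vert q k) : weight (fun i => σ (v.scope i)) =
    (∑ m, σ (v.links m)) + (σ (.chain v) - σ (.chain v.next)) := rfl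

/-- The signs with which the equations at rows and columns add up to zero. -/
def side : Bool → ZMod 3
  | false => 1
  | true => -1

open Classical in
/-- The indicator function of a vertex. -/
noncomputable def ind (v u : Vert q k) : ZMod 3 := if u = v then 1 else 0

/-- A change of the values outside of `P` can move the error in the equations from `v` to `w`. -/
def CanMove (P : Set (Var q k)) (v w : Vert q k) : Prop :=
  ∃ δ : Var q k → ZMod 3, (∀ x ∈ P, δ x = 0) ∧ ∀ u : Vert q k,
    (fun i => δ (u.scope i)) ∈ linRel q (side u.1 * (ind v u - ind w u))

/-! ### Transporting the error along links and around hubs -/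

theorem linRel_add {c d : ZMod 3} {y z : Fin (q + 4) → ZMod 3} (hy : y ∈ linRel q c)
    (hz : z ∈ linRel q d) : (fun i => y i + z i) ∈ linRel q (c + d) := by
  refine ⟨?_, by rw [weight_add, hy.2, hz.2]⟩
  linear_combination hy.1 + hz.1

theorem CanMove.trans {P : Set (Var q k)} {u v w : Vert q k} (h : CanMove P u v)
    (h' : CanMove P v w) : CanMove P u w := by
  obtain ⟨δ, h1, h2⟩ := h
  obtain ⟨δ', h1', h2'⟩ := h'
  refine ⟨fun x => δ x + δ' x, fun x hx => by simp [h1 x hx, h1' x hx], fun t => ?_⟩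
  have := linRel_add (h2 t) (h2' t)
  convert this using 2
  ring

theorem CanMove.symm {P : Set (Var q k)} {u v : Vert q k} (h : CanMove P u v) : CanMove P v u := by
  obtain ⟨δ, h1, h2⟩ := h
  refine ⟨fun x => (-1) * δ x, fun x hx => by simp [h1 x hx], fun t => ?_⟩
  obtain ⟨e1, e2⟩ := h2 t
  refine ⟨by linear_combination (-1) * e1, ?_⟩
  rw [weight_smul (-1) (fun i => δ (t.scope i)), e2]
  ring

open Classical in
-- Raising one link by 1 raises the weight by 1 at both of its ends; the opposite signs of rows and
-- columns turn this into a transport.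
theorem canMove_link {P : Set (Var q k)} {g h : Hub q k} (hP : Var.link g h ∉ P) :
    CanMove P (false, g, h.1) (true, h, g.1) := by
  refine ⟨fun x => if x = .link g h then 1 else 0, fun x hx => ?_, fun u => ⟨?_, ?_⟩⟩
  · exact if_neg (by rintro rfl; exact hP hx)
  · simp [Vert.scope_zero, Vert.scope_one, Vert.scope_two]
  · refine (weight_scope (fun x => if x = .link g h then 1 else 0) u).trans ?_
    obtain ⟨_ | _, ⟨i, m⟩, j⟩ := u <;> obtain ⟨g1, g2⟩ := g <;> obtain ⟨h1, h2⟩ := h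
    · by_cases e : i = g1 ∧ m = g2 ∧ j = h1
      · obtain ⟨rfl, rfl, rfl⟩ := e
        simp [Vert.links, side, ind]
      · have : ∀ m', ¬ ((i = g1 ∧ m = g2) ∧ j = h1 ∧ m' = h2) := by tauto
        have e' : ¬ ((i = g1 ∧ m = g2) ∧ j = h1) := by tauto
        simp [Vert.links, side, ind, this, e']
    · by_cases e : i = h1 ∧ m = h2 ∧ j = g1
      · obtain ⟨rfl, rfl, rfl⟩ := e
        simp [Vert.links, side, ind]
      · have : ∀ m', ¬ ((j = g1 ∧ m' = g2) ∧ i = h1 ∧ m = h2) := by tauto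
        have e' : ¬ ((i = h1 ∧ m = h2) ∧ j = g1) := by tauto
        simp [Vert.links, side, ind, this, e']

theorem exists_cycle_flow (j j' : ZMod (k + 1)) : ∃ a : ZMod (k + 1) → ZMod 3, ∀ p,
    a p - a (p + 1) = (if p = j then 1 else 0) - (if p = j' then 1 else 0) := by
  have main : ∀ n : ℕ, ∃ a : ZMod (k + 1) → ZMod 3, ∀ p,
      a p - a (p + 1) = (if p = j then 1 else 0) - (if p = j + n then 1 else 0) := by
    intro n
    induction n with
    | zero => exact ⟨0, by simp⟩
    | succ n ih =>
      obtain ⟨a, ha⟩ := ih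
      refine ⟨fun p => a p - if p = j + n + 1 then 1 else 0, fun p => ?_⟩
      have := ha p
      simp only [add_left_inj, Nat.cast_succ, ← add_assoc]
      linear_combination this
  obtain ⟨a, ha⟩ := main (j' - j).val
  refine ⟨a, fun p => ?_⟩
  rw [ha p, ZMod.natCast_zmod_val, add_sub_cancel]

/-- The variables which occur only at the vertices of the given hub. -/
def hubVars (s : Bool) (g : Hub q k) : Set (Var q k) :=
  {x | ∃ p, x = .chain (s, g, p) ∨ x = .slope (s, g, p)}

open Classical in
-- The flow on the cycle is determined only up to an additive constant, and this one degree of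
-- freedom suffices to leave a single pinned chain or slope variable unchanged.
theorem canMove_hub {P : Set (Var q k)} {s : Bool} {g : Hub q k}
    (hP : (P ∩ hubVars s g).Subsingleton) (j j' : ZMod (k + 1)) :
    CanMove P (s, g, j) (s, g, j') := by
  obtain ⟨a, ha⟩ := exists_cycle_flow j j'
  obtain ⟨b, hb, hc, hd⟩ : ∃ b : ZMod (k + 1) → ZMod 3,
      (∀ p, b p - b (p + 1) = (if p = j then 1 else 0) - (if p = j' then 1 else 0)) ∧
      (∀ p, .chain (s, g, p) ∈ P → b p = 0) ∧
      (∀ p, .slope (s, g, p) ∈ P → b p + b (p + 1) = 0) := by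
    by_cases h1 : ∃ p, .chain (s, g, p) ∈ P
    · obtain ⟨p, hp⟩ := h1
      refine ⟨fun t => a t - a p, fun t => by rw [← ha]; ring, fun t ht => ?_, fun t ht => ?_⟩
      · have := hP ⟨hp, p, Or.inl rfl⟩ ⟨ht, t, Or.inl rfl⟩
        simp only [Var.chain.injEq, Prod.mk.injEq, true_and] at this
        simp [this]
      · have := hP ⟨hp, p, Or.inl rfl⟩ ⟨ht, t, Or.inr rfl⟩
        simp at this
    · by_cases h2 : ∃ p, .slope (s, g, p) ∈ P
      · obtain ⟨p, hp⟩ := h2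
        -- The constant `x` must solve `a p + a (p + 1) + 2 * x = 0`, and `2 = -1` in ℤ₃.
        refine ⟨fun t => a t + (a p + a (p + 1)), fun t => by rw [← ha]; ring,
          fun t ht => (h1 ⟨t, ht⟩).elim, fun t ht => ?_⟩
        have := hP ⟨hp, p, Or.inr rfl⟩ ⟨ht, t, Or.inr rfl⟩
        simp only [Var.slope.injEq, Prod.mk.injEq, true_and] at this
        subst this
        have h3 : ∀ x y : ZMod 3, x + (x + y) + (y + (x + y)) = 0 := by decide
        exact h3 _ _
      · exact ⟨a, ha, fun t ht => (h1 ⟨t, ht⟩).elim, fun t ht => (h2 ⟨t, ht⟩).elim⟩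
  let c : Vert q k → ZMod 3 := fun v => if v.1 = s ∧ v.2.1 = g then side s * b v.2.2 else 0
  obtain ⟨δ, hl, hch, hsl⟩ : ∃ δ : Var q k → ZMod 3, (∀ g h, δ (.link g h) = 0) ∧
      (∀ v, δ (.chain v) = c v) ∧ ∀ v, δ (.slope v) = -(c v + c v.next) :=
    ⟨fun x => match x with
      | .link _ _ => 0
      | .chain v => c v
      | .slope v => -(c v + c v.next), fun _ _ => rfl, fun _ => rfl, fun _ => rfl⟩
  refine ⟨δ, ?_, fun u => ⟨?_, (weight_scope _ u).trans ?_⟩⟩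
  · rintro (⟨g', h'⟩ | ⟨s', g', p⟩ | ⟨s', g', p⟩) hx
    · exact hl _ _
    · rw [hch]
      by_cases e : s' = s ∧ g' = g
      · obtain ⟨rfl, rfl⟩ := e
        simp [c, hc p hx]
      · simp [c, e]
    · rw [hsl]
      by_cases e : s' = s ∧ g' = g
      · obtain ⟨rfl, rfl⟩ := e
        simp [c, Vert.next, ← mul_add, hd p hx]
      · simp [c, Vert.next, e]
  · simp only [Vert.scope_zero, Vert.scope_one, Vert.scope_two, hsl, hch]
    ring
  · obtain ⟨s', g', p⟩ := u
    have h0 : ∀ m, δ (Vert.links (s', g', p) m) = 0 := by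
      intro m; cases s' <;> exact hl _ _
    rw [Finset.sum_eq_zero fun m _ => h0 m, zero_add, hch, hch]
    by_cases e : s' = s ∧ g' = g
    · obtain ⟨rfl, rfl⟩ := e
      simp [c, Vert.next, ind, ← mul_sub, hb]
    · have e1 : ∀ t, ¬ (s' = s ∧ g' = g ∧ p = t) := by tauto
      simp [c, Vert.next, ind, e, e1]

/-- The variable `x` occurs at a vertex of the given hub. -/
def Var.Touches : Var q k → Bool → Hub q k → Prop
  | .link g h, s, g' => if s then h = g' else g = g'
  | .chain v, s, g' => v.1 = s ∧ v.2.1 = g'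
  | .slope v, s, g' => v.1 = s ∧ v.2.1 = g'

/-- The variables which occur in the row `g` or in a column that is linked to its `j`-th vertex. -/
def hubStar (g : Hub q k) (j : ZMod (k + 1)) : Set (Var q k) :=
  {x | x.Touches false g ∨ ∃ m, x.Touches true (j, m)}

theorem touches_of_mem_hubVars {s : Bool} {g : Hub q k} {x : Var q k} (hx : x ∈ hubVars s g) :
    x.Touches s g := by
  obtain ⟨p, rfl | rfl⟩ := hx <;> exact ⟨rfl, rfl⟩

/-- Blocking every exit needs two pins on the cycle of the row and, for each of the q + 1 columns, a
pin on the link or on the cycle of that column. These q + 3 pins are distinct. -/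
theorem exists_escape {P : Set (Var q k)} {g : Hub q k} {j : ZMod (k + 1)}
    (hP : (P ∩ hubStar g j).ncard ≤ q + 2) : (P ∩ hubVars false g).Subsingleton ∨
      ∃ m, .link g (j, m) ∉ P ∧ P ∩ hubVars true (j, m) = ∅ := by
  by_contra! hcon
  obtain ⟨h1, h2⟩ := hcon
  obtain ⟨x, hx, y, hy, hxy⟩ := h1
  have h3 : ∀ m : Fin (q + 1), ∃ z ∈ P, z = .link g (j, m) ∨ z ∈ hubVars true (j, m) := by
    intro m
    by_cases hm : Var.link g (j, m) ∈ P
    · exact ⟨_, hm, Or.inl rfl⟩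
    · obtain ⟨z, hz⟩ := h2 m hm
      exact ⟨z, hz.1, Or.inr hz.2⟩
  choose z hzP hz using h3
  have hzt : ∀ m, (z m).Touches true (j, m) := by
    intro m
    rcases hz m with h | h
    · rw [h]; simp [Var.Touches]
    · exact touches_of_mem_hubVars h
  have hzn : ∀ m, z m ∉ hubVars false g := by
    rintro m ⟨p, h⟩
    have := hzt m
    rcases h with h | h <;> · rw [h] at this; simp [Var.Touches] at this
  have hzi : Function.Injective z := by
    intro m m' e
    have h1 := hzt m
    have h2 := hzt m'
    rw [e] at h1
    revert h1 h2
    generalize z m' = t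
    rcases t with ⟨_, _⟩ | _ | _ <;> simp only [Var.Touches] <;> grind
  have hcard : (insert x (insert y (Set.range z))).ncard = q + 3 := by
    rw [Set.ncard_insert_of_notMem, Set.ncard_insert_of_notMem, ← Set.image_univ,
      Set.ncard_image_of_injective _ hzi, Set.ncard_univ, Nat.card_eq_fintype_card, Fintype.card_fin]
    · rintro ⟨m, rfl⟩; exact hzn m hy.2
    · rintro (h | ⟨m, rfl⟩)
      · exact hxy h
      · exact hzn m hx.2
  have hsub : insert x (insert y (Set.range z)) ⊆ P ∩ hubStar g j := by
    rintro _ (rfl | rfl | ⟨m, rfl⟩)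
    · exact ⟨hx.1, Or.inl (touches_of_mem_hubVars hx.2)⟩
    · exact ⟨hy.1, Or.inl (touches_of_mem_hubVars hy.2)⟩
    · exact ⟨hzP m, Or.inr ⟨m, hzt m⟩⟩
  have := Set.ncard_le_ncard hsub (Set.toFinite _)
  omega

/-- Pigeonhole, once for rows and once for columns: the hubs of a family fall into k + 1 blocks by
first coordinate, and a variable touches at most one block per family. -/
theorem exists_free_hubStar {P : Set (Var q k)} (hP : P.ncard ≤ k) :
    ∃ g j, P ∩ hubStar g j = ∅ := by
  have main : ∀ s : Bool, ∃ i : ZMod (k + 1), ∀ x ∈ P, ∀ m, ¬ x.Touches s (i, m) := by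
    intro s
    let f : Var q k → ZMod (k + 1) := fun x => match x with
      | .link g h => if s then h.1 else g.1
      | .chain v => v.2.1.1
      | .slope v => v.2.1.1
    have hf : ∀ x i m, x.Touches s (i, m) → f x = i := by
      rintro (⟨_, _⟩ | _ | _) i m h <;> simp only [Var.Touches] at h <;> cases s <;> simp_all [f]
    obtain ⟨i, hi⟩ : ∃ i, i ∉ f '' P := by
      by_contra! hcon
      have h1 := Set.ncard_image_le (f := f) (Set.toFinite P)
      rw [Set.eq_univ_of_forall hcon, Set.ncard_univ, Nat.card_zmod] at h1
      omega
    exact ⟨i, fun x hx m h => hi ⟨x, hx, hf x i m h⟩⟩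
  obtain ⟨i, hi⟩ := main false
  obtain ⟨j, hj⟩ := main true
  refine ⟨(i, 0), j, ?_⟩
  rw [Set.eq_empty_iff_forall_notMem]
  rintro x ⟨hx, h | ⟨m, h⟩⟩
  · exact hi x hx _ h
  · exact hj x hx _ h

/-- If the row `g` can be traversed, the route follows it to `j'` and crosses the free column `(j',
0)`. Otherwise it leaves at once through an unpinned column `(j, m)` and continues on the free row
`g'`. -/
theorem canMove_of_free_hubStar {P : Set (Var q k)} {g g' : Hub q k} {j j' : ZMod (k + 1)}
    (hP : (P ∩ hubStar g j).ncard ≤ q + 2) (hP' : P ∩ hubStar g' j' = ∅) :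
    CanMove P (false, g, j) (false, g', j') := by
  have free : ∀ x, x ∈ hubStar g' j' → x ∉ P := fun x hx hxP => by
    have : x ∈ P ∩ hubStar g' j' := ⟨hxP, hx⟩
    simp [hP'] at this
  have hub_sub : ∀ {s} {h : Hub q k}, P ∩ hubVars s h = ∅ → (P ∩ hubVars s h).Subsingleton :=
    fun h => h ▸ Set.subsingleton_empty
  rcases exists_escape hP with h | ⟨m, hm, hm'⟩
  · refine (canMove_hub h j j').trans ?_
    have l1 : CanMove P (false, g, j') (true, (j', 0), g.1) :=
      canMove_link (h := (j', 0)) (free _ (Or.inr ⟨0, by simp [Var.Touches]⟩))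
    have l2 : CanMove P (false, g', j') (true, (j', 0), g'.1) :=
      canMove_link (h := (j', 0)) (free _ (Or.inr ⟨0, by simp [Var.Touches]⟩))
    refine (l1.trans (canMove_hub (hub_sub ?_) _ _)).trans l2.symm
    rw [Set.eq_empty_iff_forall_notMem]
    rintro x ⟨hx, hx'⟩
    exact free x (Or.inr ⟨0, touches_of_mem_hubVars hx'⟩) hx
  · have l1 : CanMove P (false, g, j) (true, (j, m), g.1) := canMove_link (h := (j, m)) hm
    have l2 : CanMove P (false, g', j) (true, (j, m), g'.1) :=
      canMove_link (h := (j, m)) (free _ (Or.inl (by simp [Var.Touches])))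
    refine ((l1.trans (canMove_hub (hub_sub hm') _ _)).trans l2.symm).trans
      (canMove_hub (hub_sub ?_) _ _)
    rw [Set.eq_empty_iff_forall_notMem]
    rintro x ⟨hx, hx'⟩
    exact free x (Or.inl (touches_of_mem_hubVars hx')) hx

/-! ### The two structures -/

/-- The structure of the system of equations with the right-hand sides `c`: every variable has a
copy for each element of `ℤ₃`. -/
@[reducible] def liftStructure (c : Vert q k → ZMod 3) :
    (templateVoc q).Structure (Var q k × ZMod 3) :=
  structureOfRel (finRelational_templateVoc q) (fun _ R => match R with
    | .lin => fun t => ∃ v : Vert q k, (∀ i, (t i).1 = v.scope i) ∧ (fun i => (t i).2) ∈ linRel q (c v)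
    | .succ => fun t => ∃ x g, t 0 = (x, g) ∧ ∀ i : Fin (q + 3), t i.succ = (x, g + 1))

/-- The lift of the system of equations, as a finite structure. -/
def liftStr (c : Vert q k → ZMod 3) : FinStr (templateVoc q) :=
  FinStr.of (Var q k × ZMod 3) (liftStructure c)

/-- The template, as a finite structure. -/
def template (q : ℕ) : FinStr (templateVoc q) := FinStr.of (ZMod 3) (templateStructure q)

theorem liftStr_zero_mapsTo : (liftStr (0 : Vert q k → ZMod 3)).MapsTo (template q) := by
  refine ⟨⟨fun x => x.2, fun f _ => f.elim, ?_⟩⟩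
  rintro n (_ | _) t ht
  · obtain ⟨v, -, h⟩ := ht
    exact h
  · obtain ⟨x, g, h0, h⟩ := ht
    intro i
    show (t i.succ).2 = (t 0).2 + 1
    rw [h i, h0]

/-- The chain differences telescope around each cycle, and each link lies at exactly one vertex on
either side. The sum is thus independent of `s`, which is the consistency condition on the
right-hand sides. -/
theorem sum_weight_scope (η : Var q k → ZMod 3) (s : Bool) :
    ∑ g, ∑ j, weight (fun i => η (Vert.scope (s, g, j) i)) =
      ∑ g : Hub q k, ∑ h : Hub q k, η (.link g h) := by
  have hc : ∀ g : Hub q k, ∑ j, (η (.chain (s, g, j)) - η (.chain (s, g, j + 1))) = 0 := by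
    intro g
    rw [Finset.sum_sub_distrib, sub_eq_zero]
    exact (Equiv.sum_comp (Equiv.addRight (1 : ZMod (k + 1))) fun j => η (.chain (s, g, j))).symm
  have h1 : ∀ g : Hub q k, ∑ j, weight (fun i => η (Vert.scope (s, g, j) i)) =
      ∑ j, ∑ m, η (Vert.links (s, g, j) m) := by
    intro g
    simp only [weight_scope, Finset.sum_add_distrib, Vert.next, hc, add_zero]
  rw [Finset.sum_congr rfl fun g _ => h1 g]
  cases s
  · refine Finset.sum_congr rfl fun g _ => ?_
    rw [Fintype.sum_prod_type]
    rfl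
  · refine Eq.trans ?_ Finset.sum_comm
    refine Finset.sum_congr rfl fun h _ => ?_
    rw [Fintype.sum_prod_type]
    rfl

/-- The successor relation forces a homomorphism to be a translation on every fibre, so its values
at 0 form an assignment with weights `-c`. Summing these over rows and over columns gives the same
total. -/
theorem not_mapsTo_template {c : Vert q k → ZMod 3}
    (hc : ∑ g, ∑ j, c (false, g, j) ≠ ∑ g, ∑ j, c (true, g, j)) :
    ¬ (liftStr c).MapsTo (template q) := by
  rintro ⟨f⟩
  let f' : Var q k × ZMod 3 → ZMod 3 := f
  have hsucc : ∀ x g, f' (x, g + 1) = f' (x, g) + 1 := fun x g =>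
    f.map_rel' (TemplateRel.succ : TemplateRel q (q + 4)) (Fin.cons (x, g) fun _ => (x, g + 1))
      ⟨x, g, rfl, fun _ => rfl⟩ 0
  have hf : ∀ x g, f' (x, g) = f' (x, 0) + g := by
    intro x g
    have h1 := hsucc x 0
    have h2 := hsucc x 1
    fin_cases g
    · exact (add_zero _).symm
    · exact h1
    · refine h2.trans ?_
      rw [show (1 : ZMod 3) = 0 + 1 from rfl, h1, add_assoc]
      rfl
  have hlin : ∀ v : Vert q k, weight (fun i => f' (v.scope i, 0)) = - c v := by
    intro v
    -- Any tuple of weight `c v` would serve; this one puts the whole weight on one link.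
    let z : Fin (q + 1) → ZMod 3 := Pi.single 0 (c v)
    let y : Fin (q + 4) → ZMod 3 := Matrix.vecCons 0 (Matrix.vecCons 0 (Matrix.vecCons 0 z))
    have hy : y ∈ linRel q (c v) := by
      refine ⟨rfl, ?_⟩
      show (∑ m, z m) + (0 - 0) = c v
      simp [z]
    have h := f.map_rel' (TemplateRel.lin : TemplateRel q (q + 4)) (fun i => (v.scope i, y i))
      ⟨v, fun _ => rfl, hy⟩
    have h2 : weight (fun i => f' (v.scope i, y i)) = 0 := h.2
    rw [funext fun i => hf (v.scope i) (y i), weight_add, hy.2] at h2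
    linear_combination h2
  have e : ∀ s, ∑ g, ∑ j, c (s, g, j) = - ∑ g : Hub q k, ∑ h : Hub q k, f' (.link g h, 0) := by
    intro s
    rw [← sum_weight_scope (fun x => f' (x, 0)) s]
    simp only [hlin, Finset.sum_neg_distrib, neg_neg]
  exact hc ((e false).trans (e true).symm)

theorem sum_ind (g₀ : Hub q k) (j₀ : ZMod (k + 1)) :
    ∑ g, ∑ j, ind (false, g₀, j₀) ((false, g, j) : Vert q k) ≠
      ∑ g, ∑ j, ind (false, g₀, j₀) ((true, g, j) : Vert q k) := by
  classical
  have h1 : ∑ g, ∑ j, ind (false, g₀, j₀) ((false, g, j) : Vert q k) = 1 := by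
    rw [Fintype.sum_eq_single g₀, Fintype.sum_eq_single j₀]
    · simp [ind]
    · intro j hj; simp [ind, hj]
    · intro g hg; exact Finset.sum_eq_zero fun j _ => by simp [ind, hg]
  have h2 : ∑ g, ∑ j, ind (false, g₀, j₀) ((true, g, j) : Vert q k) = 0 :=
    Finset.sum_eq_zero fun g _ => Finset.sum_eq_zero fun j _ => by simp [ind]
  rw [h1, h2]
  exact one_ne_zero

/-! ### The strategy of Duplicator -/

/-- The bijection which adds `σ x` to the copies of the variable `x`. -/
def shiftEquiv (σ : Var q k → ZMod 3) : Var q k × ZMod 3 ≃ Var q k × ZMod 3 where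
  toFun a := (a.1, a.2 + σ a.1)
  invFun a := (a.1, a.2 - σ a.1)
  left_inv a := by simp
  right_inv a := by simp

/-- The variables whose copies occur in a position. -/
def pebbled {c d : Vert q k → ZMod 3} {n : ℕ} (p : GamePosition (liftStr c) (liftStr d) n) :
    Set (Var q k) :=
  {x | ∃ v a b, p v = some (a, b) ∧ (a : Var q k × ZMod 3).1 = x}

theorem ncard_pebbled_le {c d : Vert q k → ZMod 3} {n : ℕ}
    (p : GamePosition (liftStr c) (liftStr d) n) : (pebbled p).ncard ≤ n := by
  have h : some '' pebbled p ⊆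
      (fun v => (p v).map fun ab => (ab.1 : Var q k × ZMod 3).1) '' Set.univ := by
    rintro _ ⟨x, ⟨v, a, b, h, rfl⟩, rfl⟩
    exact ⟨v, trivial, by simp [h]⟩
  have h1 := Set.ncard_le_ncard h (Set.toFinite _)
  rw [Set.ncard_image_of_injective _ (Option.some_injective _)] at h1
  refine h1.trans ((Set.ncard_image_le (Set.toFinite _)).trans ?_)
  rw [Set.ncard_univ, Nat.card_eq_fintype_card, Fintype.card_fin]

/-- The invariant of the strategy: the position is given by an assignment which solves all
equations except for those at a vertex with few pebbles around it. -/
def StrategyInvariant (v₀ : Vert q k)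
    (p : GamePosition (liftStr (0 : Vert q k → ZMod 3)) (liftStr (ind v₀)) k) : Prop :=
  ∃ (g : Hub q k) (j : ZMod (k + 1)) (σ : Var q k → ZMod 3),
    (∀ u : Vert q k, (fun i => σ (u.scope i)) ∈ linRel q (ind v₀ u - ind (false, g, j) u)) ∧
    (∀ v a b, p v = some (a, b) → b = shiftEquiv σ a) ∧
    (pebbled p ∩ hubStar g j).ncard ≤ q + 2

/-- Translations respect the successor relation, and `σ` respects every equation except at the error
vertex. With so few pebbles around it, the scope of that vertex is never fully pebbled: this would
close all exits of `exists_escape`. -/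
theorem StrategyInvariant.isPartialIso {v₀ : Vert q k}
    {p : GamePosition (liftStr (0 : Vert q k → ZMod 3)) (liftStr (ind v₀)) k}
    (hp : StrategyInvariant v₀ p) : p.IsPartialIso := by
  obtain ⟨g, j, σ, hσ, hb, hcard⟩ := hp
  refine ⟨fun v w a a' b b' h h' => ?_, ?_⟩
  · rw [hb _ _ _ h, hb _ _ _ h']
    exact (shiftEquiv σ).injective.eq_iff.symm
  rintro n (_ | _) x a b hx
  · obtain rfl : b = fun i => shiftEquiv σ (a i) := funext fun i => hb _ _ _ (hx i)
    refine exists_congr fun u => and_congr_right fun hu => ?_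
    have hmem : ∀ i, u.scope i ∈ pebbled p := fun i => ⟨x i, a i, _, hx i, hu i⟩
    have hne : u ≠ (false, g, j) := by
      rintro rfl
      rcases exists_escape hcard with h | ⟨m, hm, -⟩
      · have := h ⟨hmem 0, j, Or.inr rfl⟩ ⟨hmem 1, j, Or.inl rfl⟩
        simp [Vert.scope_zero, Vert.scope_one] at this
      · exact hm (hmem m.succ.succ.succ)
    have hu' : (fun i => σ (u.scope i)) ∈ linRel q (ind v₀ u) := by
      have h0 : ind (false, g, j) u = 0 := if_neg hne
      simpa [h0] using hσ u
    have e : (fun i => (shiftEquiv σ (a i)).2) =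
        fun i => (a i : Var q k × ZMod 3).2 + σ (u.scope i) :=
      funext fun i => congrArg (fun x => (a i : Var q k × ZMod 3).2 + σ x) (hu i)
    show (fun i => (a i : Var q k × ZMod 3).2) ∈ linRel q 0 ↔
      (fun i => (shiftEquiv σ (a i)).2) ∈ linRel q (ind v₀ u)
    rw [e]
    constructor
    · intro h
      simpa using linRel_add h hu'
    · rintro ⟨h1, h2⟩
      rw [weight_add, hu'.2] at h2
      exact ⟨by linear_combination h1 - hu'.1, by linear_combination h2⟩
  · obtain rfl : b = fun i => shiftEquiv σ (a i) := funext fun i => hb _ _ _ (hx i)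
    constructor
    · rintro ⟨y, t, h0, h⟩
      refine ⟨y, t + σ y, congrArg (shiftEquiv σ) h0, fun i => ?_⟩
      show shiftEquiv σ (a i.succ) = _
      rw [h i]
      exact Prod.ext rfl (add_right_comm t 1 (σ y))
    · rintro ⟨y, t, h0, h⟩
      refine ⟨y, t - σ y, (shiftEquiv σ).injective ?_, fun i => (shiftEquiv σ).injective ?_⟩
      · refine h0.trans (Prod.ext rfl ?_)
        exact (sub_add_cancel t (σ y)).symm
      · refine (h i).trans (Prod.ext rfl ?_)
        show t + 1 = t - σ y + 1 + σ y
        ring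

/-- The error is moved to a pebble-free star before Spoiler plays, so afterwards only the q + 2
elements of his new tuple can lie in that star. -/
theorem StrategyInvariant.step {v₀ : Vert q k}
    {p : GamePosition (liftStr (0 : Vert q k → ZMod 3)) (liftStr (ind v₀)) k}
    (hp : StrategyInvariant v₀ p) :
    ∃ f : (liftStr (0 : Vert q k → ZMod 3)).carrier ≃ (liftStr (ind v₀)).carrier,
      ∀ m : SpoilerMove (liftStr (0 : Vert q k → ZMod 3)) k (q + 2), StrategyInvariant v₀
        (updateTuple p m.vars (fun i => some (m.elems i, f (m.elems i)))) := by
  obtain ⟨g, j, σ, hσ, hb, hcard⟩ := hp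
  obtain ⟨g', j', hfree⟩ := exists_free_hubStar (ncard_pebbled_le p)
  obtain ⟨δ, hδ, hδ'⟩ := canMove_of_free_hubStar hcard hfree
  refine ⟨shiftEquiv fun x => σ x + δ x, fun m => ⟨g', j', fun x => σ x + δ x, ?_, ?_, ?_⟩⟩
  · intro u
    have := linRel_add (hσ u) (hδ' u)
    convert this using 2
    -- The sign `side` is 1 at rows, and all the indicators vanish at columns.
    obtain ⟨_ | _, u⟩ := u
    · simp [side]
    · simp [side, ind]
  · intro v a b h
    rcases updateTuple_eq_ite _ _ _ h with ⟨i, -, h⟩ | ⟨-, h⟩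
    · simp only [Option.some.injEq, Prod.mk.injEq] at h
      obtain ⟨rfl, rfl⟩ := h
      rfl
    · rw [hb v a b h]
      have : δ (a : Var q k × ZMod 3).1 = 0 := hδ _ ⟨v, a, b, h, rfl⟩
      refine Prod.ext rfl ?_
      show (a : Var q k × ZMod 3).2 + σ (a : Var q k × ZMod 3).1 =
        (a : Var q k × ZMod 3).2 + (σ (a : Var q k × ZMod 3).1 + δ (a : Var q k × ZMod 3).1)
      rw [this, add_zero]
  · have hsub : pebbled (updateTuple p m.vars (fun i =>
        some (m.elems i, shiftEquiv (fun x => σ x + δ x) (m.elems i)))) ∩ hubStar g' j' ⊆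
        (fun i => (m.elems i : Var q k × ZMod 3).1) '' Set.univ := by
      rintro _ ⟨⟨v, a, b, h, rfl⟩, hx⟩
      rcases updateTuple_eq_ite _ _ _ h with ⟨i, -, h⟩ | ⟨-, h⟩
      · exact ⟨i, trivial, congrArg (fun ab => (ab.1 : Var q k × ZMod 3).1) (Option.some.inj h)⟩
      · exact ((Set.eq_empty_iff_forall_notMem.1 hfree) _ ⟨⟨v, a, b, h, rfl⟩, hx⟩).elim
    refine (Set.ncard_le_ncard hsub (Set.toFinite _)).trans
      ((Set.ncard_image_le (Set.toFinite _)).trans ?_)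
    rw [Set.ncard_univ, Nat.card_eq_fintype_card, Fintype.card_fin]

theorem duplicatorWins_liftStr (g : Hub q k) (j : ZMod (k + 1)) :
    DuplicatorWins k (q + 2) (liftStr (0 : Vert q k → ZMod 3)) (liftStr (ind (false, g, j))) := by
  refine duplicatorWins_of_invariant (StrategyInvariant (false, g, j)) ?_
    (fun p hp => hp.isPartialIso) (fun p hp => hp.step)
  refine ⟨g, j, fun _ => 0, fun u => ?_, fun v a b h => by simp at h, ?_⟩
  · simp [linRel, weight]
  · have : pebbled (fun _ => none : GamePosition (liftStr (0 : Vert q k → ZMod 3))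
        (liftStr (ind (false, g, j))) k) = ∅ := by
      simp [pebbled]
    simp [this]

/-! ### The quantifier of the template and the separation of the logics -/

theorem arity_templateVoc {q n : ℕ} (h : Nonempty ((templateVoc q).Relations n)) : n = q + 4 := by
  obtain ⟨_ | _⟩ := h <;> rfl

theorem cspQuantifier_template_mem (q : ℕ) :
    cspQuantifier (finRelational_templateVoc q) (template q) ∈
      nearUnanimityCSPQuantifiers (q + 3) (q + 4) :=
  ⟨⟨template q, rfl⟩,
    closedUnder_nearUnanimity_cspQuantifier _ (by omega) _ (isPartialPolymorphism_template q),
    fun _ h => (arity_templateVoc h).le⟩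

theorem exists_game_template (q k : ℕ) : ∃ A A' : FinStr (templateVoc q),
    A.MapsTo (template q) ∧ ¬ A'.MapsTo (template q) ∧ DuplicatorWins k (q + 2) A A' :=
  ⟨liftStr (0 : Vert q k → ZMod 3), liftStr (ind (false, (0, 0), 0)), liftStr_zero_mapsTo,
    not_mapsTo_template (sum_ind _ _), duplicatorWins_liftStr _ _⟩

theorem not_definableIn_template (q : ℕ) :
    ¬ DefinableIn (quantifiersOfArity (q + 2)) {A | A.MapsTo (template q)} :=
  not_definableIn_of_duplicatorWins (by omega) fun k _ => exists_game_template q k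

theorem mainTheorem2 (ℓ : ℕ) (hℓ : 3 ≤ ℓ) :
    ¬ LogicLE (nearUnanimityCSPQuantifiers ℓ (ℓ + 1)) (quantifiersOfArity (ℓ - 1)) ∧
    ∃ (τ : FirstOrder.Language.{0, 0}) (hτ : FinRelational τ) (S : τ.Structure (ZMod 3)),
      (∀ n, Nonempty (τ.Relations n) → n = ℓ + 1) ∧
      IsPartialPolymorphism τ (nearUnanimity ℓ (ZMod 3)) ∧
      cspQuantifier hτ (FinStr.of (ZMod 3) S) ∈ nearUnanimityCSPQuantifiers ℓ (ℓ + 1) ∧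
      ¬ DefinableIn (quantifiersOfArity (ℓ - 1))
          {A : FinStr τ | A.MapsTo (FinStr.of (ZMod 3) S)} ∧
      ∀ k : ℕ, ℓ - 1 ≤ k → ∃ A A' : FinStr τ,
        A.MapsTo (FinStr.of (ZMod 3) S) ∧ ¬ A'.MapsTo (FinStr.of (ZMod 3) S) ∧
          DuplicatorWins k (ℓ - 1) A A' := by
  obtain ⟨q, rfl⟩ : ∃ q, ℓ = q + 3 := ⟨ℓ - 3, by omega⟩
  refine ⟨fun hle => ?_, templateVoc q, finRelational_templateVoc q, templateStructure q,
    fun n h => arity_templateVoc h, isPartialPolymorphism_template q,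
    cspQuantifier_template_mem q, not_definableIn_template q, fun k _ => exists_game_template q k⟩
  have hQ := cspQuantifier_template_mem q
  obtain ⟨φ, hφ, hdef⟩ := definableIn_cls hQ hQ.2.2
  obtain ⟨k, ψ, hψ, h⟩ := hle (templateVoc q) (finRelational_templateVoc q) _ φ hφ
  exact not_definableIn_template q ⟨k, ψ, hψ, fun A => (h A).trans (hdef A)⟩
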